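/- Let $\Omega=[0,2\pi]^2$ and let $H$ be the real Hilbert space of $\Omega$-periodic fields $u(x)=\sum_{k\in\mathbb Z^2\setminus\{0\}}\hat u(k)e^{ik\cdot x}$, $\hat u(k)\in\mathbb C^2$, with $\hat u(-k)=\hat u(k)^*$, $k\cdot\hat u(k)=0$ and $\sum_k|\hat u(k)|^2<\infty$, with scalar product $(u,v)=\int_\Omega u\cdot v\,dx$ and norm $|u|=(u,u)^{1/2}$. For $s\in\mathbb R$ let $A^s$ be the power of the Stokes operator $A$, $\widehat{A^su}(k)=(k\cdot k)^s\hat u(k)$, with domain $D(A^s)=\{u\in H:\sum_k(k\cdot k)^{2s}|\hat u(k)|^2<\infty\}$, and let $B:D(A)\times D(A)\to H$ be the bilinear map $$\widehat{B(u,v)}(k)=i\sum_{j\ne0}\Big[(\hat u(k-j)\cdot j)\,\hat v(j)-\frac{(\hat u(k-j)\cdot j)(\hat v(j)\cdot k)}{k\cdot k}\,k\Big],\qquad k\neq 0$$ (with the convention $\hat u(0)=0$). Let $g\in D(A)$, $g\neq0$, satisfy $Ag=\lambda g$ with $\lambda>1$, and consider the two-dimensional Navier--Stokes equation $$\frac{du}{dt}+Au+B(u,u)=g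 .\qquad (1)$$ A solution on $\mathbb R$ is a function $u:\mathbb R\to H$ with $u(t)\in D(A)$ for all $t\in\mathbb R$ that is differentiable in $H$ and satisfies (1) for all $t\in\mathbb R$. The global attractor $\mathcal A$ is the set of all $u(0)$, where $u$ runs over the solutions on $\mathbb R$ with $\sup_{t\in\mathbb R}|u(t)|<\infty$. A ghost solution is a nonstationary (that is, not constant in time) solution $u$ on $\mathbb R$ with $u(t)\in\mathcal A$ for all $t$ such that $$\frac{d}{dt}|u(t)|^2=0\quad\text{and}\quad\frac{d}{dt}|A^{1/2}u(t)|^2=0\qquad\text{for all }t\in\mathbb R.$$ A ghost solution $u$ is called chained if there are real constants $\gamma,\beta,\alpha$, independent of $t$, such that $u(t)\in D(A^2)$ and $A^2u(t)=\gamma g+\beta u(t)+\alpha Au(t)$ for all $t\in\mathbb R$. Let $u$ be a chained ghost solution. Then for every $s\in\mathbb R$: 1. $u(t)\in D(A^s)$ for all $t\in\mathbb R$, and $|A^su(t)|$ is independent of $t$; 2. $u(t)\in D(A)\cap D(A^{2s})$ for all $t\in\mathbb R$, and $(A^{2s}u(t),B(u(t),u(t)))$ is independent of $t$. -/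

import Mathlib

open MeasureTheory

noncomputable section

namespace NSE

/-- Fourier wave numbers `k ∈ ℤ²`. -/
abbrev Wave := Fin 2 → ℤ

/-- The values `û(k) ∈ ℂ²` of the Fourier coefficients. -/
abbrev C2 := EuclideanSpace ℂ (Fin 2)

/-- The wave number `k`, as a vector of `ℂ²`. -/
def waveVec (k : Wave) : C2 := WithLp.toLp 2 (fun i => (k i : ℂ))

/-- `k · k`. -/
def waveSq (k : Wave) : ℝ := ∑ i, (k i : ℝ) ^ 2

/-- The bilinear (not sesquilinear) product `w · k` of `w ∈ ℂ²` and a wave number `k`. -/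
def dotWave (w : C2) (k : Wave) : ℂ := ∑ i, w i * (k i : ℂ)

/-- The phase space `H`: square summable families `û : ℤ² → ℂ²` of Fourier coefficients with
`û(0) = 0`, `û(-k) = û(k)*` and `k · û(k) = 0`. -/
def phaseSpace : Submodule ℝ (lp (fun _ : Wave => C2) 2) where
  carrier := {u | u 0 = 0 ∧ (∀ k i, u (-k) i = star (u k i)) ∧ ∀ k, dotWave (u k) k = 0}
  zero_mem' := by simp [dotWave]
  add_mem' := by
    rintro u v ⟨h0, h1, h2⟩ ⟨g0, g1, g2⟩
    refine ⟨by simp [h0, g0], fun k i => by simp [h1, g1], fun k => ?_⟩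
    have e := congrArg₂ (· + ·) (h2 k) (g2 k)
    simp only [dotWave, add_zero, ← Finset.sum_add_distrib, ← add_mul] at e ⊢
    exact e
  smul_mem' := by
    rintro c u ⟨h0, h1, h2⟩
    refine ⟨by simp [h0], fun k i => by simp [h1], fun k => ?_⟩
    have e := congrArg (fun z => (c : ℂ) * z) (h2 k)
    simp only [dotWave, mul_zero, Finset.mul_sum, ← mul_assoc] at e ⊢
    simpa using e

abbrev H := phaseSpace

/-- The Fourier coefficient `û(k)`. -/
def coef (u : H) (k : Wave) : C2 := (u : lp (fun _ : Wave => C2) 2) k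

theorem summable_sq_norm_coef (u : H) : Summable fun k => ‖coef u k‖ ^ 2 := by
  have h := (lp.memℓp (u : lp (fun _ : Wave => C2) 2)).summable (by norm_num)
  simpa [coef] using h

theorem H_ext {u v : H} (h : ∀ k, coef u k = coef v k) : u = v :=
  Subtype.ext (lp.ext (funext h))

/-- The element of `H` with given Fourier coefficients. -/
def ofCoef (c : Wave → C2) (hc : Summable fun k => ‖c k‖ ^ 2) (h0 : c 0 = 0)
    (h1 : ∀ k i, c (-k) i = star (c k i)) (h2 : ∀ k, dotWave (c k) k = 0) : H :=
  ⟨⟨c, memℓp_gen (by simpa using hc)⟩, h0, h1, h2⟩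

@[simp] theorem coef_ofCoef (c : Wave → C2) (hc h0 h1 h2) (k : Wave) :
    coef (ofCoef c hc h0 h1 h2) k = c k := rfl

@[simp] theorem coef_add (u v : H) (k : Wave) : coef (u + v) k = coef u k + coef v k := rfl
@[simp] theorem coef_sub (u v : H) (k : Wave) : coef (u - v) k = coef u k - coef v k := rfl
@[simp] theorem coef_smul (c : ℝ) (u : H) (k : Wave) : coef (c • u) k = c • coef u k := rfl
@[simp] theorem coef_zero_wave (u : H) : coef u 0 = 0 := u.2.1
theorem coef_neg_wave (u : H) (k : Wave) (i : Fin 2) : coef u (-k) i = star (coef u k i) :=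
  u.2.2.1 k i
theorem dotWave_coef (u : H) (k : Wave) : dotWave (coef u k) k = 0 := u.2.2.2 k

theorem waveSq_nonneg (k : Wave) : 0 ≤ waveSq k := Finset.sum_nonneg fun _ _ => sq_nonneg _

theorem waveSq_neg (k : Wave) : waveSq (-k) = waveSq k := by simp [waveSq]

theorem waveSq_ne_zero {k : Wave} (hk : k ≠ 0) : waveSq k ≠ 0 := by
  intro h
  apply hk
  ext i
  have := (Finset.sum_eq_zero_iff_of_nonneg (fun i _ => sq_nonneg ((k i : ℝ)))).1 h i
    (Finset.mem_univ i)
  simpa using this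

theorem dotWave_smul (c : ℝ) (w : C2) (k : Wave) : dotWave (c • w) k = c * dotWave w k := by
  simp [dotWave]
  ring

/-- The domain `D(A^s)`: those `u ∈ H` with `∑ (k·k)^(2s) |û(k)|² < ∞`. -/
def powDomain (s : ℝ) : Submodule ℝ H where
  carrier := {u | Summable fun k => waveSq k ^ (2 * s) * ‖coef u k‖ ^ 2}
  zero_mem' := by
    have : ∀ k, coef (0 : H) k = 0 := fun _ => rfl
    simp [this, summable_zero]
  add_mem' := by
    intro u v hu hv
    refine Summable.of_nonneg_of_le
      (fun k => mul_nonneg (Real.rpow_nonneg (waveSq_nonneg k) _) (sq_nonneg _)) (fun k => ?_)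
      ((hu.add hv).mul_left 2)
    have h1 := norm_add_le (coef u k) (coef v k)
    have h2 : ‖coef (u + v) k‖ ^ 2 ≤ 2 * (‖coef u k‖ ^ 2 + ‖coef v k‖ ^ 2) := by
      rw [coef_add]
      nlinarith [norm_nonneg (coef u k + coef v k), sq_nonneg (‖coef u k‖ - ‖coef v k‖)]
    have h3 := mul_le_mul_of_nonneg_left h2 (Real.rpow_nonneg (waveSq_nonneg k) (2 * s))
    linarith
  smul_mem' := by
    intro c u hu
    refine (hu.mul_left (c ^ 2)).congr fun k => ?_
    rw [coef_smul, norm_smul, mul_pow, Real.norm_eq_abs, sq_abs]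
    ring

/-- The power `A^s` (`s ∈ ℝ`) of the Stokes operator, an unbounded operator in `H`:
`(A^s u)^(k) = (k·k)^s û(k)` on `D(A^s)`. -/
def stokesPow (s : ℝ) : H →ₗ.[ℝ] H where
  domain := powDomain s
  toFun :=
    { toFun := fun u => ofCoef (fun k => (waveSq k ^ s) • coef (u : H) k)
        (by
          refine (show Summable _ from u.2).congr fun k => ?_
          rw [norm_smul, mul_pow, Real.norm_eq_abs, sq_abs, mul_comm 2 s,
            Real.rpow_mul (waveSq_nonneg k)]
          norm_num)
        (by simp)
        (fun k i => by simp [waveSq_neg, coef_neg_wave])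
        (fun k => by rw [dotWave_smul, dotWave_coef, mul_zero])
      map_add' := fun u v => H_ext fun k => by simp
      map_smul' := fun c u => H_ext fun k => smul_comm (waveSq k ^ s) c (coef (u : H) k) }

/-- The Stokes operator `A`, with `(A u)^(k) = (k·k) û(k)`. -/
abbrev stokes : H →ₗ.[ℝ] H := stokesPow 1

theorem coef_stokesPow (s : ℝ) (u : (stokesPow s).domain) (k : Wave) :
    coef (stokesPow s u) k = (waveSq k ^ s) • coef (u : H) k := rfl


theorem norm_waveVec_sq (k : Wave) : ‖waveVec k‖ ^ 2 = waveSq k := by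
  rw [EuclideanSpace.norm_sq_eq]
  simp [waveVec, waveSq]

theorem norm_dotWave_le (w : C2) (k : Wave) : ‖dotWave w k‖ ≤ ‖w‖ * ‖waveVec k‖ := by
  have h : dotWave w k = inner ℂ (waveVec k) w := by
    simp [dotWave, waveVec, PiLp.inner_apply]
  rw [h, mul_comm]
  exact norm_inner_le_norm _ _

/-- The `j`-th term of the series for `B̂(u,v)(k)`. -/
def advTerm (u v : H) (k j : Wave) : C2 :=
  dotWave (coef u (k - j)) j • coef v j
    - (dotWave (coef u (k - j)) j * dotWave (coef v j) k / (waveSq k : ℂ)) • waveVec k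

/-- `B̂(u,v)(k) = i ∑_j [(û(k-j)·j) v̂(j) - ((û(k-j)·j)(v̂(j)·k)/(k·k)) k]` for `k ≠ 0`. -/
def advCoef (u v : H) (k : Wave) : C2 :=
  if k = 0 then 0 else Complex.I • ∑' j, advTerm u v k j

theorem norm_advTerm_le (u v : H) (k j : Wave) :
    ‖advTerm u v k j‖ ≤ 2 * (‖coef u (k - j)‖ * (‖waveVec j‖ * ‖coef v j‖)) := by
  have h1 := norm_dotWave_le (coef u (k - j)) j
  have h2 := norm_dotWave_le (coef v j) k
  have e1 : ‖dotWave (coef u (k - j)) j • coef v j‖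
      ≤ ‖coef u (k - j)‖ * (‖waveVec j‖ * ‖coef v j‖) := by
    rw [norm_smul, ← mul_assoc]
    gcongr
  have e2 : ‖(dotWave (coef u (k - j)) j * dotWave (coef v j) k / (waveSq k : ℂ)) • waveVec k‖
      ≤ ‖coef u (k - j)‖ * (‖waveVec j‖ * ‖coef v j‖) := by
    rcases eq_or_ne (waveSq k) 0 with hk | hk
    · simp only [hk, Complex.ofReal_zero, div_zero, zero_smul, norm_zero]
      positivity
    · have hpos : 0 < waveSq k := lt_of_le_of_ne (waveSq_nonneg k) (Ne.symm hk)
      rw [norm_smul, norm_div, norm_mul, Complex.norm_real, Real.norm_eq_abs, abs_of_pos hpos,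
        div_mul_eq_mul_div, div_le_iff₀ hpos]
      calc _ ≤ (‖coef u (k - j)‖ * ‖waveVec j‖) * (‖coef v j‖ * ‖waveVec k‖) * ‖waveVec k‖ := by
            gcongr
        _ = _ := by rw [← norm_waveVec_sq]; ring
  exact (norm_sub_le _ _).trans (by linarith)

theorem summable_norm_coef (u : (stokes).domain) : Summable fun k => ‖coef (u : H) k‖ := by
  have hu : Summable fun k => waveSq k ^ (2 * (1 : ℝ)) * ‖coef (u : H) k‖ ^ 2 := u.2
  have hz := EisensteinSeries.summable_one_div_norm_rpow (k := 4) (by norm_num)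
  refine Summable.of_nonneg_of_le (fun k => norm_nonneg _) (fun k => ?_) (hz.add hu)
  rcases eq_or_ne k 0 with rfl | hk
  · rw [coef_zero_wave, norm_zero]
    exact add_nonneg (Real.rpow_nonneg (norm_nonneg _) _)
      (mul_nonneg (Real.rpow_nonneg (waveSq_nonneg _) _) (sq_nonneg _))
  · have hn : 0 < ‖k‖ := norm_pos_iff.2 hk
    have hle : ‖k‖ ^ 2 ≤ waveSq k := by
      have : ‖k‖ ≤ Real.sqrt (waveSq k) := by
        refine (pi_norm_le_iff_of_nonneg (Real.sqrt_nonneg _)).2 fun i => ?_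
        rw [Int.norm_eq_abs]
        refine Real.abs_le_sqrt ?_
        exact Finset.single_le_sum (f := fun i => (k i : ℝ) ^ 2) (fun i _ => sq_nonneg _)
          (Finset.mem_univ i)
      calc ‖k‖ ^ 2 ≤ Real.sqrt (waveSq k) ^ 2 := by gcongr
        _ = waveSq k := Real.sq_sqrt (waveSq_nonneg k)
    have e1 : ‖k‖ ^ (-4 : ℝ) = ((‖k‖ ^ 2) ^ 2)⁻¹ := by
      rw [Real.rpow_neg hn.le, ← pow_mul]
      norm_cast
    have e2 : waveSq k ^ (2 * (1 : ℝ)) = waveSq k ^ 2 := by norm_num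
    rw [e1, e2]
    have h4 : 0 < (‖k‖ ^ 2) ^ 2 := by positivity
    have h5 : (‖k‖ ^ 2) ^ 2 ≤ waveSq k ^ 2 := by gcongr
    have h6 : (‖k‖ ^ 2) ^ 2 * ‖coef (u : H) k‖ ^ 2 ≤ waveSq k ^ 2 * ‖coef (u : H) k‖ ^ 2 := by
      gcongr
    refine le_trans ?_ (add_le_add_right h6 _)
    set a := (‖k‖ ^ 2) ^ 2
    set x := ‖coef (u : H) k‖
    have h7 : 0 ≤ a⁻¹ * ((a * x - 1 / 2) ^ 2 + 3 / 4) := by positivity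
    have h8 : a⁻¹ * ((a * x - 1 / 2) ^ 2 + 3 / 4) = a⁻¹ + a * x ^ 2 - x := by
      field_simp
      ring
    linarith

theorem summable_grad_coef (v : (stokes).domain) :
    Summable fun k => (‖waveVec k‖ * ‖coef (v : H) k‖) ^ 2 := by
  have hv : Summable fun k => waveSq k ^ (2 * (1 : ℝ)) * ‖coef (v : H) k‖ ^ 2 := v.2
  refine Summable.of_nonneg_of_le (fun k => sq_nonneg _) (fun k => ?_)
    ((summable_sq_norm_coef v).add hv)
  have e2 : waveSq k ^ (2 * (1 : ℝ)) = waveSq k ^ 2 := by norm_num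
  rw [mul_pow, norm_waveVec_sq, e2]
  nlinarith [mul_nonneg (sq_nonneg (waveSq k - 1 / 2)) (sq_nonneg ‖coef (v : H) k‖),
    sq_nonneg ‖coef (v : H) k‖]

/-- The convolution of a summable and a square summable family is square summable. -/
theorem summable_conv {a b : Wave → ℝ} (ha0 : ∀ k, 0 ≤ a k) (hb0 : ∀ k, 0 ≤ b k)
    (ha : Summable a) (hb : Summable fun k => b k ^ 2) :
    (∀ k, Summable fun j => a (k - j) * b j) ∧
      Summable fun k => (∑' j, a (k - j) * b j) ^ 2 := by
  have hp : Summable fun p : Wave × Wave => a p.1 * b p.2 ^ 2 :=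
    ha.mul_of_nonneg hb ha0 fun k => sq_nonneg (b k)
  let e : Wave × Wave ≃ Wave × Wave :=
    { toFun := fun p => (p.1 - p.2, p.2)
      invFun := fun p => (p.1 + p.2, p.2)
      left_inv := fun p => by simp
      right_inv := fun p => by simp }
  have hq : Summable fun p : Wave × Wave => a (p.1 - p.2) * b p.2 ^ 2 := e.summable_iff.2 hp
  have hrow : ∀ k, Summable fun j => a (k - j) * b j ^ 2 := fun k => hq.prod_factor k
  have hak : ∀ k : Wave, HasSum (fun j => a (k - j)) (∑' j, a j) := fun k =>
    (Equiv.subLeft k).hasSum_iff.2 ha.hasSum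
  have hs : ∀ k, Summable fun j => a (k - j) * b j := fun k =>
    Summable.of_nonneg_of_le (fun j => mul_nonneg (ha0 _) (hb0 _))
      (fun j => by nlinarith [mul_nonneg (ha0 (k - j)) (sq_nonneg (b j - 1 / 2)), ha0 (k - j)])
      ((hak k).summable.add (hrow k))
  refine ⟨hs, Summable.of_nonneg_of_le (fun k => sq_nonneg _) (fun k => ?_)
    (hq.prod.mul_left (∑' j, a j))⟩
  refine le_of_tendsto ((hs k).hasSum.pow 2) (Filter.Eventually.of_forall fun s => ?_)
  calc (∑ j ∈ s, a (k - j) * b j) ^ 2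
      ≤ (∑ j ∈ s, a (k - j)) * ∑ j ∈ s, a (k - j) * b j ^ 2 :=
        Finset.sum_sq_le_sum_mul_sum_of_sq_le_mul s (fun j _ => ha0 _)
          (fun j _ => mul_nonneg (ha0 _) (sq_nonneg _)) (fun j _ => by apply le_of_eq; ring)
    _ ≤ (∑' j, a j) * ∑' j, a (k - j) * b j ^ 2 :=
        mul_le_mul (sum_le_hasSum s (fun j _ => ha0 _) (hak k))
          ((hrow k).sum_le_tsum s (fun j _ => mul_nonneg (ha0 _) (sq_nonneg _)))
          (Finset.sum_nonneg fun j _ => mul_nonneg (ha0 _) (sq_nonneg _)) (tsum_nonneg ha0)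

theorem summable_advTerm (u v : (stokes).domain) (k : Wave) :
    Summable fun j => advTerm u v k j :=
  Summable.of_norm_bounded
    (((summable_conv (fun _ => norm_nonneg _) (fun _ => by positivity) (summable_norm_coef u)
      (summable_grad_coef v)).1 k).mul_left 2) (norm_advTerm_le u v k)

theorem summable_sq_advCoef (u v : (stokes).domain) :
    Summable fun k => ‖advCoef u v k‖ ^ 2 := by
  have hc := summable_conv (fun _ => norm_nonneg _) (fun _ => by positivity)
    (summable_norm_coef u) (summable_grad_coef v)
  refine Summable.of_nonneg_of_le (fun k => sq_nonneg _) (fun k => ?_) (hc.2.mul_left 4)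
  have h : ‖advCoef u v k‖
      ≤ 2 * ∑' j, ‖coef (u : H) (k - j)‖ * (‖waveVec j‖ * ‖coef (v : H) j‖) := by
    unfold advCoef
    split_ifs
    · rw [norm_zero]
      exact mul_nonneg zero_le_two (tsum_nonneg fun _ => by positivity)
    · rw [norm_smul, Complex.norm_I, one_mul, ← tsum_mul_left]
      exact tsum_of_norm_bounded ((hc.1 k).mul_left 2).hasSum (norm_advTerm_le u v k)
  calc ‖advCoef u v k‖ ^ 2
      ≤ (2 * ∑' j, ‖coef (u : H) (k - j)‖ * (‖waveVec j‖ * ‖coef (v : H) j‖)) ^ 2 := by gcongr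
    _ = _ := by ring

theorem advTerm_neg (u v : H) (k j : Wave) (i : Fin 2) :
    advTerm u v (-k) (-j) i = -star (advTerm u v k j i) := by
  have hd : ∀ (w : H) (m l : Wave),
      dotWave (coef w (-m)) (-l) = -star (dotWave (coef w m) l) := by
    intro w m l
    simp [dotWave, coef_neg_wave]
  have hsub : -k - -j = -(k - j) := by ring
  have hd2 : dotWave (coef v (-j)) (-k) = -star (dotWave (coef v j) k) := hd v j k
  simp only [advTerm, hsub, hd, waveSq_neg, PiLp.sub_apply, PiLp.smul_apply, coef_neg_wave,
    smul_eq_mul, waveVec, Pi.neg_apply, star_sub, star_mul', star_div₀]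
  simp
  ring

/-- The `H`-valued map `B` on `D(A) × D(A)`. -/
def advB (u v : (stokes).domain) : H :=
  ofCoef (advCoef u v) (summable_sq_advCoef u v) (by simp [advCoef])
    (fun k i => by
      have hI : ∀ m, (∑' j, advTerm u v m j) i = ∑' j, advTerm (u : H) v m j i := fun m =>
        (EuclideanSpace.proj (𝕜 := ℂ) i).map_tsum (summable_advTerm u v m)
      rcases eq_or_ne k 0 with rfl | hk
      · simp [advCoef]
      · simp only [advCoef, neg_eq_zero, hk, if_false, PiLp.smul_apply, smul_eq_mul, hI]
        rw [← (Equiv.neg Wave).tsum_eq, star_mul', tsum_star]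
        simp only [Equiv.neg_apply, advTerm_neg]
        simp [tsum_neg])
    (fun k => by
      rcases eq_or_ne k 0 with rfl | hk
      · simp [dotWave]
      · have hlin : ∀ w : C2, dotWave w k = innerSL ℂ (waveVec k) w := fun w => by
          simp [dotWave, waveVec, PiLp.inner_apply]
        have hz : ∀ j, dotWave (advTerm (u : H) v k j) k = 0 := fun j => by
          have hk' : (waveSq k : ℂ) ≠ 0 := by exact_mod_cast waveSq_ne_zero hk
          have hkk : dotWave (waveVec k) k = waveSq k := by
            simp [dotWave, waveVec, waveSq, sq]
          have : dotWave (advTerm (u : H) v k j) k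
              = dotWave (coef (u : H) (k - j)) j * dotWave (coef (v : H) j) k
                - (dotWave (coef (u : H) (k - j)) j * dotWave (coef (v : H) j) k / (waveSq k : ℂ))
                  * dotWave (waveVec k) k := by
            simp only [hlin, advTerm, map_sub, map_smul, smul_eq_mul]
          rw [this, hkk]
          field_simp
          ring
        simp only [advCoef, hk, if_false]
        rw [hlin, map_smul, (innerSL ℂ (waveVec k)).map_tsum (summable_advTerm u v k)]
        simp only [← hlin, hz, tsum_zero, smul_zero])


/-- The period box `Ω = [0,2π]²`. -/
def box : Set (Fin 2 → ℝ) := Set.univ.pi fun _ => Set.Icc 0 (2 * Real.pi)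

instance : IsFiniteMeasure (volume.restrict box) :=
  ⟨by
    rw [Measure.restrict_apply_univ]
    exact (isCompact_univ_pi fun _ => isCompact_Icc).measure_lt_top⟩

/-- `e^{i k·x}`. -/
def expWave (k : Wave) (x : Fin 2 → ℝ) : ℂ := Complex.exp (Complex.I * ∑ i, (k i : ℂ) * (x i : ℂ))

theorem norm_expWave (k : Wave) (x : Fin 2 → ℝ) : ‖expWave k x‖ = 1 := by
  have : expWave k x = Complex.exp (((∑ i, (k i : ℝ) * x i : ℝ) : ℂ) * Complex.I) := by
    unfold expWave
    congr 1
    push_cast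
    ring
  rw [this, Complex.norm_exp_ofReal_mul_I]

theorem continuous_expWave (k : Wave) : Continuous (expWave k) := by
  unfold expWave
  fun_prop

theorem memLp_mode (k : Wave) (w : C2) :
    MemLp (fun x => expWave k x • w) 2 (volume.restrict box) := by
  refine MemLp.of_bound ((continuous_expWave k).smul continuous_const).aestronglyMeasurable ‖w‖
    (Filter.Eventually.of_forall fun x => ?_)
  rw [norm_smul, norm_expWave, one_mul]

/-- The monochromatic field `w e^{i k·x}` in `L²(Ω)²`. -/
def mode (k : Wave) (w : C2) : Lp C2 2 (volume.restrict box) := (memLp_mode k w).toLp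

/-- The velocity field `u(x) = ∑_k û(k) e^{i k·x}` in `L²(Ω)²`. -/
def field (u : H) : Lp C2 2 (volume.restrict box) := ∑' k, mode k (coef u k)

/-- The scalar product `(u,v) = ∫_Ω u(x)·v(x) dx` of `H`. -/
def ip (u v : H) : ℝ := ∫ x in box, ∑ i, (field u x i * star (field v x i)).re

theorem integral_expWave (k l : Wave) :
    ∫ x in box, star (expWave k x) * expWave l x
      = if k = l then ((2 * Real.pi) ^ 2 : ℂ) else 0 := by
  have h1 : ∀ x : Fin 2 → ℝ, star (expWave k x) * expWave l x
      = ∏ i, Complex.exp ((((l i - k i : ℤ) : ℂ) * Complex.I) * (x i : ℂ)) := fun x => by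
    rw [← Complex.exp_sum, expWave, expWave, Complex.star_def, ← Complex.exp_conj,
      ← Complex.exp_add]
    congr 1
    simp
    ring
  have h2 : ∀ n : ℤ, ∫ t in Set.Icc 0 (2 * Real.pi), Complex.exp (((n : ℂ) * Complex.I) * (t : ℂ))
      = if n = 0 then (2 * Real.pi : ℂ) else 0 := fun n => by
    rw [integral_Icc_eq_integral_Ioc,
      ← intervalIntegral.integral_of_le (by positivity : (0 : ℝ) ≤ 2 * Real.pi)]
    split_ifs with hn
    · simp [hn]
    · have hn' : (n : ℂ) * Complex.I ≠ 0 := by simp [hn]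
      rw [integral_exp_mul_complex hn']
      have : Complex.exp ((n : ℂ) * Complex.I * ((2 * Real.pi : ℝ) : ℂ)) = 1 := by
        rw [Complex.exp_eq_one_iff]
        exact ⟨n, by push_cast; ring⟩
      rw [this]
      simp
  simp only [h1]
  rw [box, volume_pi, Measure.restrict_pi_pi,
    integral_fintype_prod_eq_prod (𝕜 := ℂ)
      (fun i (t : ℝ) => Complex.exp ((((l i - k i : ℤ) : ℂ) * Complex.I) * (t : ℂ)))]
  simp only [h2, sub_eq_zero]
  split_ifs with hkl
  · simp [hkl, sq]
  · obtain ⟨i, hi⟩ := Function.ne_iff.1 hkl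
    exact Finset.prod_eq_zero (Finset.mem_univ i) (if_neg (Ne.symm hi))

theorem inner_mode (k l : Wave) (w z : C2) :
    inner ℂ (mode k w) (mode l z)
      = if k = l then ((2 * Real.pi) ^ 2 : ℂ) * inner ℂ w z else 0 := by
  rw [L2.inner_def]
  have : ∫ x in box, inner ℂ (mode k w x) (mode l z x)
      = ∫ x in box, (star (expWave k x) * expWave l x) * inner ℂ w z := by
    refine integral_congr_ae ?_
    filter_upwards [(memLp_mode k w).coeFn_toLp, (memLp_mode l z).coeFn_toLp] with x hx hy
    rw [mode, mode, hx, hy, inner_smul_left, inner_smul_right, Complex.star_def]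
    ring
  rw [this, integral_mul_const, integral_expWave]
  split_ifs <;> simp

theorem summable_mode (u : H) : Summable fun k => mode k (coef u k) := by
  have hπ : (0 : ℝ) < 2 * Real.pi := by positivity
  let V : ∀ _ : Wave, C2 →ₗᵢ[ℂ] Lp C2 2 (volume.restrict box) := fun k =>
    LinearMap.isometryOfInner
      { toFun := fun w => ((2 * Real.pi : ℝ) : ℂ)⁻¹ • mode k w
        map_add' := fun w z => by
          rw [← smul_add]
          congr 1
          rw [mode, mode, mode, ← MemLp.toLp_add]
          congr 1
          ext x
          simp
        map_smul' := fun c w => by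
          rw [RingHom.id_apply, smul_comm c]
          congr 1
          rw [mode, mode, ← MemLp.toLp_const_smul]
          congr 1
          ext x
          simp
          ring }
      (fun w z => by
        have : (Real.pi : ℂ) ≠ 0 := by exact_mod_cast Real.pi_ne_zero
        simp only [LinearMap.coe_mk, AddHom.coe_mk, inner_smul_left, inner_smul_right, inner_mode,
          if_true]
        simp only [map_inv₀, Complex.conj_ofReal]
        push_cast
        field_simp)
  have hV : OrthogonalFamily ℂ (fun _ : Wave => C2) V := fun k l hkl w z => by
    change inner ℂ (((2 * Real.pi : ℝ) : ℂ)⁻¹ • mode k w) (((2 * Real.pi : ℝ) : ℂ)⁻¹ • mode l z) = 0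
    rw [inner_smul_left, inner_smul_right, inner_mode, if_neg hkl, mul_zero, mul_zero]
  have h := ((hV.summable_iff_norm_sq_summable (coef u)).2 (summable_sq_norm_coef u)).const_smul
    (((2 * Real.pi : ℝ) : ℂ))
  refine h.congr fun k => ?_
  have : ((2 * Real.pi : ℝ) : ℂ) ≠ 0 := by exact_mod_cast hπ.ne'
  exact smul_inv_smul₀ this (mode k (coef u k))

/-- Parseval's identity for the scalar product of `H`. -/
theorem hasSum_ip (u v : H) :
    HasSum (fun k => (2 * Real.pi) ^ 2 * (inner ℂ (coef u k) (coef v k)).re) (ip u v) := by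
  have e : ip u v = (inner ℂ (field u) (field v)).re := by
    rw [L2.inner_def, ip]
    have hi := L2.integrable_inner (𝕜 := ℂ) (field u) (field v)
    have h := integral_re hi
    simp only [RCLike.re_eq_complex_re] at h
    rw [← h]
    refine integral_congr_ae (Filter.Eventually.of_forall fun x => ?_)
    simp [PiLp.inner_apply]
    ring
  have h1 : ∀ l, inner ℂ (field u) (mode l (coef v l))
      = ((2 * Real.pi) ^ 2 : ℂ) * inner ℂ (coef u l) (coef v l) := fun l => by
    have h := (summable_mode u).hasSum.mapL (innerSL ℂ (mode l (coef v l)))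
    have h' := h.unique (hasSum_single l fun k hk => by
      rw [innerSL_apply_apply, inner_mode, if_neg hk.symm])
    rw [innerSL_apply_apply, innerSL_apply_apply, inner_mode, if_pos rfl] at h'
    have h2 : (starRingEnd ℂ) ((2 * Real.pi) ^ 2 : ℂ) = (2 * Real.pi) ^ 2 := by
      have : ((2 * Real.pi) ^ 2 : ℂ) = (((2 * Real.pi) ^ 2 : ℝ) : ℂ) := by push_cast; rfl
      rw [this, Complex.conj_ofReal]
    rw [← inner_conj_symm, field, h', map_mul, inner_conj_symm, h2]
  have h2 := (summable_mode v).hasSum.mapL (innerSL ℂ (field u))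
  simp only [innerSL_apply_apply, h1] at h2
  rw [e]
  have h3 := Complex.reCLM.hasSum h2
  have h4 : ∀ z : ℂ, (((2 * Real.pi) ^ 2 : ℂ) * z).re = (2 * Real.pi) ^ 2 * z.re := fun z => by
    have : ((2 * Real.pi) ^ 2 : ℂ) = (((2 * Real.pi) ^ 2 : ℝ) : ℂ) := by push_cast; rfl
    rw [this, Complex.re_ofReal_mul]
  simp only [Complex.reCLM_apply, h4] at h3
  exact h3

/-- `|u| = (u,u)^{1/2}`. -/
def hnorm (u : H) : ℝ := Real.sqrt (ip u u)

/-- `u : ℝ → H` solves `du/dt + A u + B(u,u) = g` on all of `ℝ`, with `u(t) ∈ D(A)`. -/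
def IsSolution (g : H) (u : ℝ → H) : Prop :=
  ∀ t, ∃ h : u t ∈ (stokes).domain,
    HasDerivAt u (g - stokes ⟨u t, h⟩ - advB ⟨u t, h⟩ ⟨u t, h⟩) t

/-- The global attractor: the values at time `0` of the solutions that are bounded in `H` on `ℝ`. -/
def attractor (g : H) : Set H :=
  {u₀ | ∃ u : ℝ → H, IsSolution g u ∧ u 0 = u₀ ∧ BddAbove (Set.range fun t => hnorm (u t))}

/-- A ghost solution: a nonstationary solution in the global attractor with constant energy
`|u|²` and constant enstrophy `|A^{1/2} u|²`. -/
structure IsGhost (g : H) (u : ℝ → H) : Prop where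
  isSolution : IsSolution g u
  mem_attractor : ∀ t, u t ∈ attractor g
  nonstationary : ¬ ∃ u₀, ∀ t, u t = u₀
  energy : ∀ t, HasDerivAt (fun t => hnorm (u t) ^ 2) 0 t
  enstrophy : ∃ h : ∀ t, u t ∈ (stokesPow (1 / 2)).domain,
    ∀ t, HasDerivAt (fun t => hnorm (stokesPow (1 / 2) ⟨u t, h t⟩) ^ 2) 0 t

/-- A chained ghost solution: a ghost solution with `A² u(t) = γ g + β u(t) + α A u(t)` for all `t`,
where `γ`, `β`, `α` do not depend on `t`. -/
def IsChainedGhost (g : H) (u : ℝ → H) : Prop :=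
  IsGhost g u ∧ ∃ γ β α : ℝ, ∀ t, ∃ (h₁ : u t ∈ (stokes).domain) (h₂ : u t ∈ (stokesPow 2).domain),
    stokesPow 2 ⟨u t, h₂⟩ = γ • g + β • u t + α • stokes ⟨u t, h₁⟩

end NSE
end

namespace NSE

/-! On the Fourier side the chain relation reads `p(|k|²) û(k,t) = γ ĝ(k)` with `p(x) = x² - αx -
β`. Where `p(|k|²) ≠ 0` the coefficient is therefore frozen in time, and it vanishes unless `|k|² =
λ`. Only modes on the at most two shells given by the roots of `p` can move. Hence `u` stays a
trigonometric polynomial with modes in a box that does not depend on `t`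
(`exists_waveBox_of_chain`), and membership in every domain is automatic.

An arbitrary weight `f(|k|²)` agrees on the roots of `p` with an affine function `a + b|k|²`. So the
`f`-weighted energy is `a` times the energy plus `b` times the enstrophy plus a contribution of
frozen modes, all constant up to the common factor `(2π)²` (`sum_weight_const_of_chain`). Claim 1 is
the weight `x ^ (2s)`.

For claim 2, a conserved weighted energy turns the equation into an identity expressing the weighted
pairing of `u` with `B(u,u)` through that of `u` with `g` and another weighted energy
(`weighted_balance`). As `g` lives on one shell, its weighted pairing with `u` is `f(λ)(u,g)`.
Finally `(u,g)` is constant: with `f = 1` the orthogonality `sum_inner_advCoef` makes it equal to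
the enstrophy. -/

/-- Two values of a function can be interpolated by an affine function. -/
theorem exists_affine_eq_on_quadratic_roots (f : ℝ → ℝ) (α β : ℝ) :
    ∃ a b : ℝ, ∀ x, x ^ 2 = α * x + β → f x = a + b * x := by
  by_cases h : ∃ x y : ℝ, x ^ 2 = α * x + β ∧ y ^ 2 = α * y + β ∧ x ≠ y
  · obtain ⟨x, y, hx, hy, hxy⟩ := h
    have hd : x - y ≠ 0 := sub_ne_zero.2 hxy
    -- Vieta: with two distinct roots the quadratic factors, so every further root `z` satisfies `(z
    -- - x)(z - y) = 0`.
    have hsum : x + y = α := by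
      apply mul_left_cancel₀ hd
      linear_combination hx - hy
    refine ⟨f x - (f x - f y) / (x - y) * x, (f x - f y) / (x - y), fun z hz => ?_⟩
    have hz' : (z - x) * (z - y) = 0 := by
      linear_combination hz - hx + (x - z) * hsum
    rcases mul_eq_zero.1 hz' with h | h
    · rw [sub_eq_zero.1 h]
      ring
    · rw [sub_eq_zero.1 h]
      field_simp
      ring
  · push Not at h
    by_cases hx : ∃ x : ℝ, x ^ 2 = α * x + β
    · obtain ⟨x, hx⟩ := hx
      exact ⟨f x, 0, fun z hz => by rw [h z x hz hx]; ring⟩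
    · push Not at hx
      exact ⟨0, 0, fun z hz => absurd hz (hx z)⟩

/-! ### Fields with finitely many Fourier modes -/

/-- A finite box of wave numbers, symmetric under `k ↦ -k`. -/
noncomputable def waveBox (N : ℤ) : Finset Wave := Fintype.piFinset fun _ => Finset.Icc (-N) N

theorem neg_mem_waveBox {N : ℤ} {k : Wave} : -k ∈ waveBox N ↔ k ∈ waveBox N := by
  simp only [waveBox, Fintype.mem_piFinset, Finset.mem_Icc, Pi.neg_apply]
  exact forall_congr' fun i => by omega

theorem mem_waveBox_of_waveSq_le {N : ℤ} {k : Wave} (h : waveSq k ≤ N) : k ∈ waveBox N := by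
  simp only [waveBox, Fintype.mem_piFinset, Finset.mem_Icc]
  intro i
  have h1 : (k i : ℝ) ^ 2 ≤ waveSq k :=
    Finset.single_le_sum (f := fun i => (k i : ℝ) ^ 2) (fun i _ => sq_nonneg _)
      (Finset.mem_univ i)
  have h2 : (k i) ^ 2 ≤ N := by exact_mod_cast h1.trans h
  have h3 : |k i| ≤ k i ^ 2 := by
    rw [← sq_abs]
    exact Int.le_self_sq _
  exact abs_le.1 (h3.trans h2)

theorem coef_stokes (u : (stokes).domain) (k : Wave) :
    coef (stokes u) k = waveSq k • coef (u : H) k := by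
  rw [coef_stokesPow, Real.rpow_one]

theorem coef_advB (u v : (stokes).domain) (k : Wave) : coef (advB u v) k = advCoef u v k := rfl

/-- The Fourier coefficient at `k`, as a continuous linear map. -/
noncomputable def coefL (k : Wave) : H →L[ℝ] C2 :=
  LinearMap.mkContinuous
    { toFun := fun u => coef u k
      map_add' := fun u v => coef_add u v k
      map_smul' := fun c u => coef_smul c u k } 1
    fun u => by
      rw [one_mul]
      exact lp.norm_apply_le_norm (by norm_num) (u : lp (fun _ : Wave => C2) 2) k

theorem hasDerivAt_coef {u : ℝ → H} {u' : H} {t : ℝ} (h : HasDerivAt u u' t) (k : Wave) :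
    HasDerivAt (fun t => coef (u t) k) (coef u' k) t :=
  (coefL k).hasFDerivAt.comp_hasDerivAt t h

theorem ip_eq_sum {u v : H} {F : Finset Wave} (hF : ∀ k ∉ F, coef u k = 0) :
    ip u v = (2 * Real.pi) ^ 2 * ∑ k ∈ F, (inner ℂ (coef u k) (coef v k)).re := by
  rw [Finset.mul_sum]
  refine (hasSum_ip u v).unique (hasSum_sum_of_ne_finset_zero fun k hk => ?_)
  simp [hF k hk]

theorem re_inner_self_C2 (w : C2) : (inner ℂ w w).re = ‖w‖ ^ 2 :=
  inner_self_eq_norm_sq (𝕜 := ℂ) w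

theorem hnorm_sq_eq_sum {u : H} {F : Finset Wave} (hF : ∀ k ∉ F, coef u k = 0) :
    hnorm u ^ 2 = (2 * Real.pi) ^ 2 * ∑ k ∈ F, ‖coef u k‖ ^ 2 := by
  have h := ip_eq_sum (v := u) hF
  simp only [re_inner_self_C2] at h
  rw [hnorm, Real.sq_sqrt, h]
  rw [h]
  positivity

theorem norm_rpow_smul_sq (s : ℝ) (k : Wave) (w : C2) :
    ‖(waveSq k ^ s) • w‖ ^ 2 = waveSq k ^ (2 * s) * ‖w‖ ^ 2 := by
  rw [norm_smul, mul_pow, Real.norm_eq_abs, sq_abs, mul_comm 2 s, Real.rpow_mul (waveSq_nonneg k)]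
  norm_num

theorem hnorm_stokesPow_sq_eq_sum {s : ℝ} (u : (stokesPow s).domain) {F : Finset Wave}
    (hF : ∀ k ∉ F, coef (u : H) k = 0) :
    hnorm (stokesPow s u) ^ 2
      = (2 * Real.pi) ^ 2 * ∑ k ∈ F, waveSq k ^ (2 * s) * ‖coef (u : H) k‖ ^ 2 := by
  rw [hnorm_sq_eq_sum (F := F) fun k hk => by rw [coef_stokesPow, hF k hk, smul_zero]]
  simp only [coef_stokesPow, norm_rpow_smul_sq]

theorem mem_stokesPow_domain_of_finite {u : H} {F : Finset Wave} (hF : ∀ k ∉ F, coef u k = 0)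
    (s : ℝ) : u ∈ (stokesPow s).domain :=
  summable_of_ne_finset_zero (s := F) fun k hk => by simp [hF k hk]

/-! ### Orthogonality of the advection term -/

/-- Reality of the field turns reflection into conjugation, which exchanges the two arguments. -/
theorem inner_coef_neg_neg (u : H) (j k : Wave) :
    inner ℂ (coef u (-j)) (coef u (-k)) = inner ℂ (coef u k) (coef u j) := by
  simp only [PiLp.inner_apply, RCLike.inner_apply, coef_neg_wave]
  simp [mul_comm]

theorem inner_coef_waveVec (u : H) (k : Wave) : inner ℂ (coef u k) (waveVec k) = 0 := by
  have h : dotWave (coef u k) k = inner ℂ (waveVec k) (coef u k) := by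
    simp [dotWave, waveVec, PiLp.inner_apply]
  rw [← inner_conj_symm, ← h, dotWave_coef, map_zero]

/-- Incompressibility at the wave number `k - j`; this supplies the antisymmetry of the trilinear
form. -/
theorem dotWave_coef_sub (u : H) (k j : Wave) :
    dotWave (coef u (k - j)) k = dotWave (coef u (k - j)) j := by
  have h := dotWave_coef u (k - j)
  rw [← sub_eq_zero, ← h]
  simp only [dotWave, ← Finset.sum_sub_distrib, ← mul_sub]
  simp

theorem dotWave_neg (w : C2) (k : Wave) : dotWave w (-k) = -dotWave w k := by
  simp [dotWave]

/-- The pressure part is parallel to `k`, hence orthogonal to `û(k)`, and the series stops because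
`û(j)` vanishes off `F`. -/
theorem inner_coef_advCoef {u : H} {F : Finset Wave} (hF : ∀ k ∉ F, coef u k = 0) (k : Wave) :
    inner ℂ (coef u k) (advCoef u u k)
      = Complex.I * ∑ j ∈ F, dotWave (coef u (k - j)) j * inner ℂ (coef u k) (coef u j) := by
  rcases eq_or_ne k 0 with rfl | hk
  · simp
  · rw [advCoef, if_neg hk, inner_smul_right, tsum_eq_sum (s := F), inner_sum]
    · congr 1
      refine Finset.sum_congr rfl fun j _ => ?_
      rw [advTerm, inner_sub_right, inner_smul_right, inner_smul_right, inner_coef_waveVec,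
        mul_zero, sub_zero]
    · intro j hj
      simp [advTerm, hF j hj, dotWave]

/-- The orthogonality `(u, B(u,u)) = 0`, for a trigonometric polynomial `u`. -/
theorem sum_inner_advCoef {u : H} {N : ℤ} (hF : ∀ k ∉ waveBox N, coef u k = 0) :
    ∑ k ∈ waveBox N, inner ℂ (coef u k) (advCoef u u k) = 0 := by
  simp only [inner_coef_advCoef hF, ← Finset.mul_sum]
  refine mul_eq_zero_of_right _ (self_eq_neg.1 ?_)
  have hneg : ∀ f : Wave → ℂ, ∑ k ∈ waveBox N, f (-k) = ∑ k ∈ waveBox N, f k := fun f =>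
    Finset.sum_equiv (Equiv.neg Wave) (fun k => by simp [neg_mem_waveBox]) (fun k _ => rfl)
  -- Reflecting both indices and then exchanging them maps the double sum to its own negative.
  conv_lhs =>
    rw [← hneg]
    enter [2, k]
    rw [← hneg]
  rw [Finset.sum_comm, ← Finset.sum_neg_distrib]
  refine Finset.sum_congr rfl fun k _ => ?_
  rw [← Finset.sum_neg_distrib]
  refine Finset.sum_congr rfl fun j _ => ?_
  rw [inner_coef_neg_neg, dotWave_neg, show -j - -k = k - j by ring, dotWave_coef_sub, neg_mul]

/-! ### Balance law for weighted spectral energies -/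

theorem hasDerivAt_sum_weight {u : ℝ → H} {u' : H} {t : ℝ} (h : HasDerivAt u u' t)
    (F : Finset Wave) (f : Wave → ℝ) :
    HasDerivAt (fun t => ∑ k ∈ F, f k * ‖coef (u t) k‖ ^ 2)
      (∑ k ∈ F, f k * (2 * (inner ℂ (coef (u t) k) (coef u' k)).re)) t := by
  refine HasDerivAt.fun_sum fun k _ => HasDerivAt.const_mul _ ?_
  have hk := hasDerivAt_coef h k
  have hre : ∀ w z : C2, inner ℝ w z = (inner ℂ w z).re := fun w z => by
    simp [PiLp.inner_apply, Complex.inner]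
  rw [← hre]
  exact hk.norm_sq

/-- The derivative of the conserved sum, computed from the equation, must vanish; the factor 2 from
differentiating the squares cancels. -/
theorem weighted_balance {g : H} {u : ℝ → H} (hu : IsSolution g u) (F : Finset Wave)
    (f : Wave → ℝ)
    (hc : ∀ t t', ∑ k ∈ F, f k * ‖coef (u t) k‖ ^ 2 = ∑ k ∈ F, f k * ‖coef (u t') k‖ ^ 2)
    (t : ℝ) :
    ∑ k ∈ F, f k * (inner ℂ (coef (u t) k) (advCoef (u t) (u t) k)).re
      = ∑ k ∈ F, f k * (inner ℂ (coef (u t) k) (coef g k)).re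
        - ∑ k ∈ F, f k * (waveSq k * ‖coef (u t) k‖ ^ 2) := by
  obtain ⟨h, hd⟩ := hu t
  have h1 := hasDerivAt_sum_weight hd F f
  have h2 : HasDerivAt (fun t => ∑ k ∈ F, f k * ‖coef (u t) k‖ ^ 2) 0 t := by
    rw [funext fun t' => hc t' t]
    exact hasDerivAt_const _ _
  have h3 := h1.unique h2
  have h4 : ∀ k, (inner ℂ (coef (u t) k) (waveSq k • coef (u t) k)).re
      = waveSq k * ‖coef (u t) k‖ ^ 2 := fun k => by
    rw [inner_smul_right_eq_smul, Complex.smul_re, re_inner_self_C2, smul_eq_mul]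
  simp only [coef_sub, coef_stokes, coef_advB, inner_sub_right, Complex.sub_re, h4] at h3
  rw [← Finset.sum_sub_distrib, ← sub_eq_zero, ← Finset.sum_sub_distrib,
    ← mul_right_inj' (two_ne_zero' ℝ), mul_zero, Finset.mul_sum, ← neg_eq_zero,
    ← Finset.sum_neg_distrib, ← h3]
  exact Finset.sum_congr rfl fun k _ => by ring

/-! ### Spectral consequences of the chain relation -/

theorem coef_eq_zero_of_stokes_eq_smul {lam : ℝ} {g : H} (hg : g ∈ (stokes).domain)
    (hAg : stokes ⟨g, hg⟩ = lam • g) {k : Wave} (hk : waveSq k ≠ lam) : coef g k = 0 := by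
  have h := congrArg (fun v => coef v k) hAg
  simp only [coef_stokes, coef_smul] at h
  rw [← sub_eq_zero, ← sub_smul] at h
  exact (smul_eq_zero.1 h).resolve_left (sub_ne_zero.2 hk)

theorem coef_of_chain {g u : H} {γ β α : ℝ} (h₁ : u ∈ (stokes).domain)
    (h₂ : u ∈ (stokesPow 2).domain)
    (h : stokesPow 2 ⟨u, h₂⟩ = γ • g + β • u + α • stokes ⟨u, h₁⟩) (k : Wave) :
    (waveSq k ^ 2 - (α * waveSq k + β)) • coef u k = γ • coef g k := by
  have h := congrArg (fun v => coef v k) h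
  simp only [coef_add, coef_smul, coef_stokesPow, Real.rpow_one, Real.rpow_two] at h
  rw [sub_smul, h, add_smul, mul_smul]
  abel

/-- A family of fields with a quadratic spectral relation driven by an eigenfunction has its
Fourier modes in a common finite box. -/
theorem exists_waveBox_of_chain {lam γ β α : ℝ} {g : H}
    (hg : ∀ k, waveSq k ≠ lam → coef g k = 0) :
    ∃ N : ℤ, ∀ u : H,
      (∀ k, (waveSq k ^ 2 - (α * waveSq k + β)) • coef u k = γ • coef g k) →
      ∀ k ∉ waveBox N, coef u k = 0 := by
  -- Beyond `|lam|` the forcing has no mode; beyond `1 + |α| + |β|` the quadratic `x² - αx - β` is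
  -- positive. The bound does not involve `u`, so one box serves all times.
  refine ⟨⌈|lam| + (1 + |α| + |β|)⌉, fun u hu k hk => ?_⟩
  have h1 : |lam| + (1 + |α| + |β|) < waveSq k := by
    by_contra! h
    exact hk (mem_waveBox_of_waveSq_le (h.trans (Int.le_ceil _)))
  have hα := le_abs_self α
  have hβ := le_abs_self β
  have hl := le_abs_self lam
  have h0α := abs_nonneg α
  have h0β := abs_nonneg β
  have h0l := abs_nonneg lam
  have h2 := hu k
  rw [hg k (by linarith), smul_zero] at h2
  refine (smul_eq_zero.1 h2).resolve_left (ne_of_gt ?_)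
  have h3 : (1 + |α| + |β|) * waveSq k ≤ waveSq k * waveSq k :=
    mul_le_mul_of_nonneg_right (by linarith) (waveSq_nonneg k)
  have h4 : α * waveSq k ≤ |α| * waveSq k := by
    gcongr
    exact waveSq_nonneg k
  have h5 : |β| * 1 ≤ |β| * waveSq k := by
    gcongr
    linarith
  nlinarith

/-- Two fields with the same driven quadratic spectral relation, the same energy and the same
enstrophy have the same weighted spectral energies. -/
theorem sum_weight_const_of_chain {γ β α : ℝ} {g : H} {u v : H} {F : Finset Wave}
    (hu : ∀ k, (waveSq k ^ 2 - (α * waveSq k + β)) • coef u k = γ • coef g k)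
    (hv : ∀ k, (waveSq k ^ 2 - (α * waveSq k + β)) • coef v k = γ • coef g k)
    (h0 : ∑ k ∈ F, ‖coef u k‖ ^ 2 = ∑ k ∈ F, ‖coef v k‖ ^ 2)
    (h1 : ∑ k ∈ F, waveSq k * ‖coef u k‖ ^ 2 = ∑ k ∈ F, waveSq k * ‖coef v k‖ ^ 2)
    (f : ℝ → ℝ) :
    ∑ k ∈ F, f (waveSq k) * ‖coef u k‖ ^ 2 = ∑ k ∈ F, f (waveSq k) * ‖coef v k‖ ^ 2 := by
  obtain ⟨a, b, hab⟩ := exists_affine_eq_on_quadratic_roots f α β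
  have hk : ∀ k, (f (waveSq k) - (a + b * waveSq k)) * ‖coef u k‖ ^ 2
      = (f (waveSq k) - (a + b * waveSq k)) * ‖coef v k‖ ^ 2 := fun k => by
    -- On a root the corrected weight is zero; off the roots the relation determines the
    -- coefficient, so both fields share it.
    by_cases hr : waveSq k ^ 2 = α * waveSq k + β
    · rw [hab _ hr, sub_self, zero_mul, zero_mul]
    · rw [smul_right_injective C2 (sub_ne_zero.2 hr) ((hu k).trans (hv k).symm)]
  have hsplit : ∀ w : H, ∑ k ∈ F, f (waveSq k) * ‖coef w k‖ ^ 2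
      = ∑ k ∈ F, (f (waveSq k) - (a + b * waveSq k)) * ‖coef w k‖ ^ 2
        + (a * ∑ k ∈ F, ‖coef w k‖ ^ 2 + b * ∑ k ∈ F, waveSq k * ‖coef w k‖ ^ 2) := fun w => by
    rw [Finset.mul_sum, Finset.mul_sum, ← Finset.sum_add_distrib, ← Finset.sum_add_distrib]
    exact Finset.sum_congr rfl fun k _ => by ring
  rw [hsplit u, hsplit v, h0, h1]
  simp only [hk]

theorem eq_of_hasDerivAt_zero {f : ℝ → ℝ} (h : ∀ t, HasDerivAt f 0 t) (t t' : ℝ) :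
    f t = f t' :=
  is_const_of_deriv_eq_zero (fun t => (h t).differentiableAt) (fun t => (h t).deriv) t t'

end NSE

/-! ### Conserved quantities of chained ghost solutions -/

theorem mainTheorem12 (lam : ℝ) (hlam : 1 < lam) (g : NSE.H) (hg0 : g ≠ 0)
    (hg : g ∈ NSE.stokes.domain) (hAg : NSE.stokes ⟨g, hg⟩ = lam • g)
    (u : ℝ → NSE.H) (hu : NSE.IsChainedGhost g u) (s : ℝ) :
    (∃ h : ∀ t, u t ∈ (NSE.stokesPow s).domain,
      ∀ t t', NSE.hnorm (NSE.stokesPow s ⟨u t, h t⟩) = NSE.hnorm (NSE.stokesPow s ⟨u t', h t'⟩)) ∧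
    (∃ (h : ∀ t, u t ∈ NSE.stokes.domain) (h' : ∀ t, u t ∈ (NSE.stokesPow (2 * s)).domain),
      ∀ t t', NSE.ip (NSE.stokesPow (2 * s) ⟨u t, h' t⟩) (NSE.advB ⟨u t, h t⟩ ⟨u t, h t⟩)
        = NSE.ip (NSE.stokesPow (2 * s) ⟨u t', h' t'⟩)
            (NSE.advB ⟨u t', h t'⟩ ⟨u t', h t'⟩)) := by
  open NSE in
  obtain ⟨hgh, γ, β, α, hch⟩ := hu
  have hgk : ∀ k, waveSq k ≠ lam → coef g k = 0 := fun k hk =>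
    coef_eq_zero_of_stokes_eq_smul hg hAg hk
  have hrel : ∀ t k, (waveSq k ^ 2 - (α * waveSq k + β)) • coef (u t) k = γ • coef g k :=
    fun t k => by
      obtain ⟨h₁, h₂, h⟩ := hch t
      exact coef_of_chain h₁ h₂ h k
  obtain ⟨N, hN⟩ := exists_waveBox_of_chain (γ := γ) (β := β) (α := α) hgk
  have hF : ∀ t, ∀ k ∉ waveBox N, coef (u t) k = 0 := fun t => hN (u t) (hrel t)
  have hdom : ∀ (r t : ℝ), u t ∈ (stokesPow r).domain := fun r t =>
    mem_stokesPow_domain_of_finite (hF t) r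
  have hπ : (2 * Real.pi) ^ 2 ≠ 0 := by positivity
  have hE : ∀ t t', ∑ k ∈ waveBox N, ‖coef (u t) k‖ ^ 2
      = ∑ k ∈ waveBox N, ‖coef (u t') k‖ ^ 2 := fun t t' => by
    have h := eq_of_hasDerivAt_zero hgh.energy t t'
    simp only [hnorm_sq_eq_sum (hF _)] at h
    exact mul_left_cancel₀ hπ h
  have hZ : ∀ t t', ∑ k ∈ waveBox N, waveSq k * ‖coef (u t) k‖ ^ 2
      = ∑ k ∈ waveBox N, waveSq k * ‖coef (u t') k‖ ^ 2 := fun t t' => by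
    obtain ⟨hd, he⟩ := hgh.enstrophy
    have h := eq_of_hasDerivAt_zero he t t'
    simp only [hnorm_stokesPow_sq_eq_sum ⟨u _, hd _⟩ (hF _)] at h
    have e : (2 * (1 / 2) : ℝ) = 1 := by norm_num
    simp only [e, Real.rpow_one] at h
    exact mul_left_cancel₀ hπ h
  have hW : ∀ (f : ℝ → ℝ) (t t' : ℝ), ∑ k ∈ waveBox N, f (waveSq k) * ‖coef (u t) k‖ ^ 2
      = ∑ k ∈ waveBox N, f (waveSq k) * ‖coef (u t') k‖ ^ 2 := fun f t t' =>
    sum_weight_const_of_chain (hrel t) (hrel t') (hE t t') (hZ t t') f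
  have hB : ∀ (f : ℝ → ℝ) (t : ℝ), _ := fun f t =>
    weighted_balance hgh.isSolution (waveBox N) (fun k => f (waveSq k)) (hW f) t
  have hG : ∀ t t', ∑ k ∈ waveBox N, (inner ℂ (coef (u t) k) (coef g k)).re
      = ∑ k ∈ waveBox N, (inner ℂ (coef (u t') k) (coef g k)).re := fun t t' => by
    have hbal : ∀ t, ∑ k ∈ waveBox N, (inner ℂ (coef (u t) k) (coef g k)).re
        = ∑ k ∈ waveBox N, waveSq k * ‖coef (u t) k‖ ^ 2 := fun t => by
      -- Unit weight: the advection side vanishes by orthogonality, leaving forcing equal to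
      -- dissipation.
      have h := hB (fun _ => 1) t
      simp only [one_mul] at h
      rw [← Complex.re_sum, sum_inner_advCoef (hF t), Complex.zero_re] at h
      exact (sub_eq_zero.1 h.symm)
    rw [hbal, hbal, hZ t t']
  refine ⟨⟨hdom s, fun t t' => ?_⟩, ⟨hdom 1, hdom (2 * s), fun t t' => ?_⟩⟩
  · refine (pow_left_inj₀ (Real.sqrt_nonneg _) (Real.sqrt_nonneg _) two_ne_zero).1 ?_
    change hnorm _ ^ 2 = hnorm _ ^ 2
    rw [hnorm_stokesPow_sq_eq_sum ⟨u t, hdom s t⟩ (hF t),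
      hnorm_stokesPow_sq_eq_sum ⟨u t', hdom s t'⟩ (hF t'), hW (fun x => x ^ (2 * s)) t t']
  · have hval : ∀ t, ip (stokesPow (2 * s) ⟨u t, hdom (2 * s) t⟩)
          (advB ⟨u t, hdom 1 t⟩ ⟨u t, hdom 1 t⟩)
        = (2 * Real.pi) ^ 2 *
          (lam ^ (2 * s) * ∑ k ∈ waveBox N, (inner ℂ (coef (u t) k) (coef g k)).re
            - ∑ k ∈ waveBox N, (waveSq k ^ (2 * s) * waveSq k) * ‖coef (u t) k‖ ^ 2) :=
      fun t => by
        rw [ip_eq_sum (F := waveBox N) fun k hk => by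
          rw [coef_stokesPow, hF t k hk, smul_zero]]
        congr 1
        simp only [coef_stokesPow, coef_advB, inner_smul_left_eq_smul, Complex.smul_re,
          smul_eq_mul]
        rw [hB (fun x => x ^ (2 * s)) t, Finset.mul_sum]
        congr 1
        -- Only the shell `waveSq k = lam` contributes to the forcing, so the weight comes out as
        -- the constant `lam ^ (2 * s)`.
        · refine Finset.sum_congr rfl fun k _ => ?_
          by_cases hk : waveSq k = lam
          · rw [hk]
          · rw [hgk k hk, inner_zero_right, Complex.zero_re, mul_zero, mul_zero]
        · exact Finset.sum_congr rfl fun k _ => (mul_assoc _ _ _).symm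
    rw [hval t, hval t', hG t t', hW (fun x => x ^ (2 * s) * x) t t']
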